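/- **Theorem.** Let $H$ be a quaternion skew field with centre $F$, i.e. a skew field with centre $F$ and $\dim_F H=4$ (the characteristic is arbitrary). Let $\mathbb P(H)$ be the projective space whose points and lines are the one- and two-dimensional $F$-subspaces of $H$. Two lines $M,N$ are called left parallel, $M\parallel_\ell N$, if $cM=N$ for some $c\in H\setminus\{0\}$, and right parallel, $M\parallel_r N$, if $Md=N$ for some $d\in H\setminus\{0\}$. A parallelism on $\mathbb P(H)$ is an equivalence relation on the set of lines such that each point is on precisely one line of each equivalence class. The parallelisms $\parallel_\ell$ and $\parallel_r$ make $\mathbb P(H)$ into a projective double space $(\mathbb P(H),\parallel_\ell,\parallel_r)$: for every triangle $p_0,p_1,p_2$, the line through $p_2$ left parallel to the join of $p_0,p_1$ and the line through $p_1$ right parallel to the join of $p_0,p_2$ have a common point. A parallelism $\parallel$ on $\mathbb P(H)$ is called Clifford-like (with respect to $\parallel_\ell,\parallel_r$) if for all lines $M,N$, $M\parallel N$ implies $M\parallel_\ell N$ or $M\parallel_r N$. Then the following are equivalent. (a) $F$ is a formally real Pythagorean field (i.e. $-1$ is not a square in $F$, and the sum of any two squares in $F$ is a square in $F$), and $H$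 is the ordinary quaternion skew field over $F$, that is, $H$ is $F$-isomorphic to the quaternion algebra with $F$-basis $1,i,j,k$, where $i^2=j^2=-1$ and $ij=k=-ji$. (b) Any two maximal (commutative) subfields of $H$ are $F$-isomorphic. (c) The Clifford-like parallelisms of $(\mathbb P(H),\parallel_\ell,\parallel_r)$ are precisely $\parallel_\ell$ and $\parallel_r$. -/

import Mathlib

/-- Points of the projective space on `V`: one-dimensional subspaces. -/
abbrev ProjPoint (F V : Type*) [Field F] [AddCommGroup V] [Module F V] : Type _ :=
  {W : Submodule F V // Module.finrank F W = 1}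

/-- Lines of the projective space on `V`: two-dimensional subspaces. -/
abbrev ProjLine (F V : Type*) [Field F] [AddCommGroup V] [Module F V] : Type _ :=
  {W : Submodule F V // Module.finrank F W = 2}

/-- An equivalence relation on the set of lines is a parallelism if each point is incident with
precisely one line of each equivalence class. -/
def IsParallelism {F V : Type*} [Field F] [AddCommGroup V] [Module F V]
    (s : Setoid (ProjLine F V)) : Prop :=
  ∀ (q : ProjPoint F V) (M : ProjLine F V), ∃! N : ProjLine F V, s M N ∧ q.1 ≤ N.1

/-- A projective double space: a projective space with a left and a right parallelism satisfying
the double space axiom.  A triangle `p₀, p₁, p₂` is a triple of points spanning a plane; `L₁` is the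
join of `p₀, p₁` and `L₂` is the join of `p₀, p₂`. -/
structure ProjectiveDoubleSpace (F V : Type*) [Field F] [AddCommGroup V] [Module F V] where
  left : Setoid (ProjLine F V)
  right : Setoid (ProjLine F V)
  left_isParallelism : IsParallelism left
  right_isParallelism : IsParallelism right
  double_space : ∀ p₀ p₁ p₂ : ProjPoint F V,
    Module.finrank F (p₀.1 ⊔ p₁.1 ⊔ p₂.1 : Submodule F V) = 3 →
    ∀ L₁ L₂ M₁ M₂ : ProjLine F V,
      p₀.1 ≤ L₁.1 → p₁.1 ≤ L₁.1 → p₀.1 ≤ L₂.1 → p₂.1 ≤ L₂.1 →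
      left M₁ L₁ → p₂.1 ≤ M₁.1 → right M₂ L₂ → p₁.1 ≤ M₂.1 →
      ∃ q : ProjPoint F V, q.1 ≤ M₁.1 ∧ q.1 ≤ M₂.1

/-- Clifford-like parallelisms of a projective double space. -/
def ProjectiveDoubleSpace.IsCliffordLike {F V : Type*} [Field F] [AddCommGroup V] [Module F V]
    (D : ProjectiveDoubleSpace F V) (s : Setoid (ProjLine F V)) : Prop :=
  IsParallelism s ∧ ∀ M N : ProjLine F V, s M N → D.left M N ∨ D.right M N

section Clifford

variable (F H : Type*) [Field F] [DivisionRing H] [Algebra F H]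

/-- Left parallel lines: `c M = N` for some `c ≠ 0`. -/
def leftParallel : Setoid (ProjLine F H) where
  r M N := ∃ c : H, c ≠ 0 ∧ M.1.map (LinearMap.mulLeft F c) = N.1
  iseqv :=
    { refl := fun M => ⟨1, one_ne_zero, by
        rw [LinearMap.mulLeft_one, Submodule.map_id]⟩
      symm := by
        rintro M N ⟨c, hc, h⟩
        refine ⟨c⁻¹, inv_ne_zero hc, ?_⟩
        rw [← h, ← Submodule.map_comp, ← LinearMap.mulLeft_mul, inv_mul_cancel₀ hc,
          LinearMap.mulLeft_one, Submodule.map_id]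
      trans := by
        rintro M N P ⟨c, hc, h⟩ ⟨d, hd, k⟩
        refine ⟨d * c, mul_ne_zero hd hc, ?_⟩
        rw [LinearMap.mulLeft_mul, Submodule.map_comp, h, k] }

/-- Right parallel lines: `M d = N` for some `d ≠ 0`. -/
def rightParallel : Setoid (ProjLine F H) where
  r M N := ∃ d : H, d ≠ 0 ∧ M.1.map (LinearMap.mulRight F d) = N.1
  iseqv :=
    { refl := fun M => ⟨1, one_ne_zero, by
        rw [LinearMap.mulRight_one, Submodule.map_id]⟩
      symm := by
        rintro M N ⟨c, hc, h⟩
        refine ⟨c⁻¹, inv_ne_zero hc, ?_⟩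
        rw [← h, ← Submodule.map_comp, ← LinearMap.mulRight_mul, mul_inv_cancel₀ hc,
          LinearMap.mulRight_one, Submodule.map_id]
      trans := by
        rintro M N P ⟨c, hc, h⟩ ⟨d, hd, k⟩
        refine ⟨c * d, mul_ne_zero hc hd, ?_⟩
        rw [LinearMap.mulRight_mul, Submodule.map_comp, h, k] }

variable {F H}

/-- A two-dimensional subspace containing `1` is closed under multiplication. -/
theorem mul_mem_of_finrank_two [Algebra.IsCentral F H] (h4 : Module.finrank F H = 4)
    (L : Submodule F H) (hL : Module.finrank F L = 2) (h1 : (1 : H) ∈ L)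
    {a b : H} (ha : a ∈ L) (hb : b ∈ L) : a * b ∈ L := by
  have : FiniteDimensional F H := Module.finite_of_finrank_pos (by omega)
  obtain ⟨g, hgL, hg⟩ : ∃ g ∈ L, g ∉ (⊥ : Subalgebra F H) := by
    by_contra hcon
    push Not at hcon
    have hle : L ≤ Subalgebra.toSubmodule (⊥ : Subalgebra F H) := fun x hx => hcon x hx
    have := Submodule.finrank_mono hle
    rw [Subalgebra.finrank_toSubmodule, Subalgebra.finrank_bot] at this
    omega
  have hspan : L = Submodule.span F {1, g} := by
    symm
    apply Submodule.eq_of_le_of_finrank_eq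
    · rw [Submodule.span_le]
      rintro x (rfl | rfl)
      · exact h1
      · exact hgL
    · rw [hL]
      have hli : LinearIndependent F ![(1 : H), g] := by
        rw [LinearIndependent.pair_iff' one_ne_zero]
        intro c hc
        exact hg (by rw [Algebra.mem_bot]; exact ⟨c, by rw [← hc, Algebra.smul_def, mul_one]⟩)
      have := finrank_span_eq_card hli
      rwa [Matrix.range_cons, Matrix.range_cons, Matrix.range_empty, Set.union_empty,
        Set.singleton_union, Fintype.card_fin] at this
  let S : Subalgebra F H := Algebra.adjoin F {g}
  have hLS : L ≤ Subalgebra.toSubmodule S := by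
    rw [hspan, Submodule.span_le]
    rintro x (rfl | rfl)
    · exact S.one_mem
    · exact Algebra.subset_adjoin rfl
  let _ : DivisionRing S := divisionRingOfFiniteDimensional F S
  have hmul : Module.finrank F S * Module.finrank S H = 4 := by
    rw [← h4]; exact Module.finrank_mul_finrank F S H
  have hge : 2 ≤ Module.finrank F S := by
    have := Submodule.finrank_mono hLS
    rw [hL] at this
    exact this
  have hne : Module.finrank F S ≠ 4 := by
    intro hS
    have htop : S = ⊤ := by
      apply Subalgebra.eq_of_le_of_finrank_eq le_top
      rw [hS, ← h4]
      exact (Subalgebra.topEquiv (R := F) (A := H)).toLinearEquiv.finrank_eq.symm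
    have hcomm : ∀ x ∈ S, g * x = x * g := by
      intro x hx
      exact Algebra.commute_of_mem_adjoin_self hx
    apply hg
    apply Algebra.IsCentral.out
    rw [Subalgebra.mem_center_iff]
    intro x
    exact (hcomm x (htop ▸ Algebra.mem_top)).symm
  have h2 : Module.finrank F S = 2 := by
    have hdvd : Module.finrank F S ∣ 4 := ⟨_, hmul.symm⟩
    have hle := Nat.le_of_dvd (by norm_num) hdvd
    interval_cases hh : Module.finrank F S
    · rfl
    · omega
    · exact absurd rfl hne
  have hEq : L = Subalgebra.toSubmodule S :=
    Submodule.eq_of_le_of_finrank_eq hLS (by rw [hL]; exact h2.symm)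
  rw [hEq] at ha hb ⊢
  exact S.mul_mem ha hb

theorem finrank_map_mulLeft {c : H} (hc : c ≠ 0) (M : Submodule F H) :
    Module.finrank F (M.map (LinearMap.mulLeft F c)) = Module.finrank F M :=
  (Submodule.equivMapOfInjective _ (fun _ _ h => mul_left_cancel₀ hc h) M).finrank_eq.symm

theorem finrank_map_mulRight {c : H} (hc : c ≠ 0) (M : Submodule F H) :
    Module.finrank F (M.map (LinearMap.mulRight F c)) = Module.finrank F M :=
  (Submodule.equivMapOfInjective _ (fun _ _ h => mul_right_cancel₀ hc h) M).finrank_eq.symm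

theorem leftParallel_unique [Algebra.IsCentral F H] (h4 : Module.finrank F H = 4)
    {M N : ProjLine F H} (h : leftParallel F H M N) {p : H} (hp : p ≠ 0)
    (hM : p ∈ M.1) (hN : p ∈ N.1) : M = N := by
  have : FiniteDimensional F H := Module.finite_of_finrank_pos (by omega)
  obtain ⟨c, hc, h⟩ := h
  have hp' := inv_ne_zero hp
  let L := M.1.map (LinearMap.mulLeft F p⁻¹)
  have hL : Module.finrank F L = 2 := (finrank_map_mulLeft hp' M.1).trans M.2
  have h1 : (1 : H) ∈ L := ⟨p, hM, by simp [hp]⟩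
  rw [← h] at hN
  obtain ⟨m, hm, hmp⟩ := hN
  have hmp : c * m = p := hmp
  have hml : p⁻¹ * m ∈ L := ⟨m, hm, rfl⟩
  apply Subtype.ext
  apply Submodule.eq_of_le_of_finrank_eq _ (M.2.trans N.2.symm)
  intro x hx
  have hxl : p⁻¹ * x ∈ L := ⟨x, hx, rfl⟩
  obtain ⟨y, hy, hyx⟩ := mul_mem_of_finrank_two h4 L hL h1 hml hxl
  have hyx : p⁻¹ * y = p⁻¹ * m * (p⁻¹ * x) := hyx
  rw [← h]
  refine ⟨y, hy, ?_⟩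
  change c * y = x
  have : y = m * (p⁻¹ * x) := by
    rw [mul_assoc] at hyx
    exact mul_left_cancel₀ hp' hyx
  rw [this, ← mul_assoc, hmp, ← mul_assoc, mul_inv_cancel₀ hp, one_mul]

theorem rightParallel_unique [Algebra.IsCentral F H] (h4 : Module.finrank F H = 4)
    {M N : ProjLine F H} (h : rightParallel F H M N) {p : H} (hp : p ≠ 0)
    (hM : p ∈ M.1) (hN : p ∈ N.1) : M = N := by
  have : FiniteDimensional F H := Module.finite_of_finrank_pos (by omega)
  obtain ⟨c, hc, h⟩ := h
  have hp' := inv_ne_zero hp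
  let L := M.1.map (LinearMap.mulRight F p⁻¹)
  have hL : Module.finrank F L = 2 := (finrank_map_mulRight hp' M.1).trans M.2
  have h1 : (1 : H) ∈ L := ⟨p, hM, by simp [hp]⟩
  rw [← h] at hN
  obtain ⟨m, hm, hmp⟩ := hN
  have hmp : m * c = p := hmp
  have hml : m * p⁻¹ ∈ L := ⟨m, hm, rfl⟩
  apply Subtype.ext
  apply Submodule.eq_of_le_of_finrank_eq _ (M.2.trans N.2.symm)
  intro x hx
  have hxl : x * p⁻¹ ∈ L := ⟨x, hx, rfl⟩
  obtain ⟨y, hy, hyx⟩ := mul_mem_of_finrank_two h4 L hL h1 hxl hml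
  have hyx : y * p⁻¹ = x * p⁻¹ * (m * p⁻¹) := hyx
  rw [← h]
  refine ⟨y, hy, ?_⟩
  change y * c = x
  have : y = x * p⁻¹ * m := by
    rw [← mul_assoc] at hyx
    exact mul_right_cancel₀ hp' hyx
  rw [this, mul_assoc, hmp, mul_assoc, inv_mul_cancel₀ hp, mul_one]

theorem ProjPoint.exists_eq_span (q : ProjPoint F H) :
    ∃ p : H, p ≠ 0 ∧ q.1 = Submodule.span F {p} := by
  obtain ⟨v, hv, hs⟩ := finrank_eq_one_iff'.mp q.2
  refine ⟨v, fun h => hv (Subtype.ext h), le_antisymm (fun x hx => ?_) ?_⟩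
  · obtain ⟨c, hc⟩ := hs ⟨x, hx⟩
    exact Submodule.mem_span_singleton.mpr ⟨c, congrArg Subtype.val hc⟩
  · rw [Submodule.span_singleton_le_iff_mem]
    exact v.2

variable (F H)

theorem leftParallel_isParallelism [Algebra.IsCentral F H] (h4 : Module.finrank F H = 4) :
    IsParallelism (leftParallel F H) := by
  intro q M
  obtain ⟨p, hp, hq⟩ := q.exists_eq_span
  have hne : M.1 ≠ ⊥ := by
    intro hb
    have := M.2
    rw [hb, finrank_bot] at this
    omega
  obtain ⟨m, hm, hm0⟩ := Submodule.exists_mem_ne_zero_of_ne_bot hne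
  have hc : p * m⁻¹ ≠ 0 := mul_ne_zero hp (inv_ne_zero hm0)
  simp only [hq, Submodule.span_singleton_le_iff_mem]
  let N : ProjLine F H := ⟨M.1.map (LinearMap.mulLeft F (p * m⁻¹)),
    (finrank_map_mulLeft hc M.1).trans M.2⟩
  have hN : leftParallel F H M N := ⟨_, hc, rfl⟩
  have hpN : p ∈ N.1 := ⟨m, hm, by simp [hm0]⟩
  refine ⟨N, ⟨hN, hpN⟩, ?_⟩
  rintro N' ⟨hN', hpN'⟩
  exact leftParallel_unique h4 (Setoid.trans' _ (Setoid.symm' _ hN') hN) hp hpN' hpN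

theorem rightParallel_isParallelism [Algebra.IsCentral F H] (h4 : Module.finrank F H = 4) :
    IsParallelism (rightParallel F H) := by
  intro q M
  obtain ⟨p, hp, hq⟩ := q.exists_eq_span
  have hne : M.1 ≠ ⊥ := by
    intro hb
    have := M.2
    rw [hb, finrank_bot] at this
    omega
  obtain ⟨m, hm, hm0⟩ := Submodule.exists_mem_ne_zero_of_ne_bot hne
  have hc : m⁻¹ * p ≠ 0 := mul_ne_zero (inv_ne_zero hm0) hp
  simp only [hq, Submodule.span_singleton_le_iff_mem]
  let N : ProjLine F H := ⟨M.1.map (LinearMap.mulRight F (m⁻¹ * p)),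
    (finrank_map_mulRight hc M.1).trans M.2⟩
  have hN : rightParallel F H M N := ⟨_, hc, rfl⟩
  have hpN : p ∈ N.1 := ⟨m, hm, by simp [hm0]⟩
  refine ⟨N, ⟨hN, hpN⟩, ?_⟩
  rintro N' ⟨hN', hpN'⟩
  exact rightParallel_unique h4 (Setoid.trans' _ (Setoid.symm' _ hN') hN) hp hpN' hpN

/-- The projective double space of a quaternion skew field `H` with centre `F`. -/
def cliffordDoubleSpace [Algebra.IsCentral F H] (h4 : Module.finrank F H = 4) :
    ProjectiveDoubleSpace F H where
  left := leftParallel F H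
  right := rightParallel F H
  left_isParallelism := leftParallel_isParallelism F H h4
  right_isParallelism := rightParallel_isParallelism F H h4
  double_space := by
    intro p₀ p₁ p₂ _ L₁ L₂ M₁ M₂ h01 h11 h02 h22 hl h2 hr h1
    obtain ⟨a, ha, e0⟩ := p₀.exists_eq_span
    obtain ⟨b, hb, e1⟩ := p₁.exists_eq_span
    obtain ⟨c, hc, e2⟩ := p₂.exists_eq_span
    rw [e0, Submodule.span_singleton_le_iff_mem] at h01 h02
    rw [e1, Submodule.span_singleton_le_iff_mem] at h11 h1
    rw [e2, Submodule.span_singleton_le_iff_mem] at h22 h2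
    have hu : c * a⁻¹ ≠ 0 := mul_ne_zero hc (inv_ne_zero ha)
    have hv : a⁻¹ * b ≠ 0 := mul_ne_zero (inv_ne_zero ha) hb
    let N₁ : ProjLine F H := ⟨L₁.1.map (LinearMap.mulLeft F (c * a⁻¹)),
      (finrank_map_mulLeft hu L₁.1).trans L₁.2⟩
    let N₂ : ProjLine F H := ⟨L₂.1.map (LinearMap.mulRight F (a⁻¹ * b)),
      (finrank_map_mulRight hv L₂.1).trans L₂.2⟩
    have k1 : leftParallel F H L₁ N₁ := ⟨_, hu, rfl⟩
    have k2 : rightParallel F H L₂ N₂ := ⟨_, hv, rfl⟩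
    have q1 : M₁ = N₁ := leftParallel_unique h4 (Setoid.trans' _ hl k1) hc h2
      ⟨a, h01, by simp [ha]⟩
    have q2 : M₂ = N₂ := rightParallel_unique h4 (Setoid.trans' _ hr k2) hb h1
      ⟨a, h02, by simp [ha]⟩
    refine ⟨⟨Submodule.span F {c * a⁻¹ * b}, finrank_span_singleton (mul_ne_zero hu hb)⟩, ?_, ?_⟩
    · rw [Submodule.span_singleton_le_iff_mem, q1]
      exact ⟨b, h11, rfl⟩
    · rw [Submodule.span_singleton_le_iff_mem, q2]
      exact ⟨c, h22, by simp [mul_assoc]⟩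

/-- Maximal (commutative) subfields of `H`, as `F`-subalgebras: since `F` is the centre of `H`,
every maximal subfield of `H` contains `F`. -/
def IsMaximalSubfield (K : Subalgebra F H) : Prop :=
  Maximal (fun S : Subalgebra F H => IsField S) K

end Clifford

/-- `-1` is not a square. Together with `IsPythagoreanField` this says that `-1` is not a sum of
squares. -/
def IsFormallyRealField (F : Type*) [Field F] : Prop := ¬ IsSquare (-1 : F)

/-- The sum of any two squares is a square. -/
def IsPythagoreanField (F : Type*) [Field F] : Prop := ∀ x y : F, IsSquare (x ^ 2 + y ^ 2)

/-- `H` is the ordinary quaternion skew field over `F`, i.e. it is `F`-isomorphic to the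
quaternion algebra with `F`-basis `1, i, j, k = i j = - j i` and `i² = j² = -1`.  The isomorphism
forces the latter to be a skew field. -/
def IsOrdinaryQuaternionSkewField (F H : Type*) [Field F] [DivisionRing H] [Algebra F H] : Prop :=
  Nonempty (H ≃ₐ[F] Quaternion F)

/-!
A line through `1` is the same thing as a maximal subfield `F(g)`, and each left class and each
right class contains exactly one line through `1`. Everything reduces to the following condition:
any two lines `M`, `N` are linked by some `P` with `M ∥ₗ P ∥ᵣ N`; for lines through `1` this says
that `M` and `N` are conjugate.

* Clifford-like parallelisms (`ProjectiveDoubleSpace.setOf_isCliffordLike_eq_iff`). Every class of a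
  Clifford-like parallelism is a left class or a right class. If any two lines are linked, every
  left class meets every right class, so a Clifford-like parallelism cannot have classes of both
  kinds; this uses that no left class is a right class, which holds since no maximal subfield is
  normalized by all of `H`. Conversely, if `M₀` is not linked to every line, then left parallelism
  on the lines linked to `M₀`, blended with right parallelism on the others, is a third
  Clifford-like parallelism.
* If any two lines are linked, any two maximal subfields are conjugate and hence isomorphic
  (`nonempty_algEquiv_of_linked`).
* If the maximal subfields are isomorphic (`quaternion_of_isomorphic`), the characteristic is not
  two, because in characteristic two there are both separable and inseparable ones. For `g` of trace
  zero, a nonzero commutator `h = c g - g c` anticommutes with `g`. All noncentral elements with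
  square in `F` have their squares in a single square class; comparing `g`, `h` and `g h` shows that
  it is the class of `-1`, which gives `i` and `j`. Comparing `i` with `x i + y j` shows that `F` is
  Pythagorean.
* Over a Pythagorean field every line through `1` contains a `u` with `u² = -1`, and
  `u (u + v) = (u + v) v` whenever `u² = v² = -1`, so any two such lines are conjugate
  (`linked_of_ordinary`).
-/

/-! ### Clifford-like parallelisms of a double space -/

section DoubleSpace

variable {F V : Type*} [Field F] [AddCommGroup V] [Module F V]

theorem ProjLine.exists_point_le (M : ProjLine F V) : ∃ q : ProjPoint F V, q.1 ≤ M.1 := by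
  have hne : M.1 ≠ ⊥ := by
    intro hb
    have := M.2
    rw [hb, finrank_bot] at this
    omega
  obtain ⟨m, hm, hm0⟩ := Submodule.exists_mem_ne_zero_of_ne_bot hne
  exact ⟨⟨Submodule.span F {m}, finrank_span_singleton hm0⟩,
    (Submodule.span_singleton_le_iff_mem _ _).2 hm⟩

/-- If one class of a parallelism lies in a class of another parallelism, the two classes are
equal, because each of them partitions the points. -/
theorem IsParallelism.class_eq_of_le {s t : Setoid (ProjLine F V)} (hs : IsParallelism s)
    (ht : IsParallelism t) {M : ProjLine F V} (h : ∀ N, s M N → t M N) (N : ProjLine F V) :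
    s M N ↔ t M N := by
  refine ⟨h N, fun hN => ?_⟩
  obtain ⟨q, hq⟩ := N.exists_point_le
  obtain ⟨N', ⟨h1, h2⟩, -⟩ := hs q M
  rwa [(ht q M).unique ⟨hN, hq⟩ ⟨h N' h1, h2⟩]

namespace ProjectiveDoubleSpace

variable {D : ProjectiveDoubleSpace F V}

/-- Each class of a Clifford-like parallelism is a left class or a right class. -/
theorem IsCliffordLike.class_eq {s : Setoid (ProjLine F V)} (hs : D.IsCliffordLike s)
    (M : ProjLine F V) : (∀ N, s M N ↔ D.left M N) ∨ (∀ N, s M N ↔ D.right M N) := by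
  by_cases h : ∀ N, s M N → D.left M N
  · exact Or.inl (hs.1.class_eq_of_le D.left_isParallelism h)
  refine Or.inr (hs.1.class_eq_of_le D.right_isParallelism fun N hN => ?_)
  push Not at h
  obtain ⟨P, hP, hPl⟩ := h
  have hPr := (hs.2 M P hP).resolve_left hPl
  rcases hs.2 M N hN with hl | hr
  · rcases hs.2 N P (s.trans' (s.symm' hN) hP) with h' | h'
    · exact absurd (D.left.trans' hl h') hPl
    · exact D.right.trans' hPr (D.right.symm' h')
  · exact hr

/-- The equivalence relation that agrees with left parallelism on a set `S` of lines and with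
right parallelism outside `S`, where `S` is a union of left classes and of right classes. -/
def blend (D : ProjectiveDoubleSpace F V) (S : Set (ProjLine F V))
    (hl : ∀ M N, D.left M N → M ∈ S → N ∈ S) (hr : ∀ M N, D.right M N → M ∈ S → N ∈ S) :
    Setoid (ProjLine F V) where
  r M N := (M ∈ S ∧ D.left M N) ∨ (M ∉ S ∧ D.right M N)
  iseqv :=
    { refl := fun M => (em (M ∈ S)).imp (⟨·, D.left.refl' M⟩) (⟨·, D.right.refl' M⟩)
      symm := by
        rintro M N (⟨hM, h⟩ | ⟨hM, h⟩)
        · exact Or.inl ⟨hl _ _ h hM, D.left.symm' h⟩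
        · exact Or.inr ⟨fun hN => hM (hr _ _ (D.right.symm' h) hN), D.right.symm' h⟩
      trans := by
        rintro M N P (⟨hM, h⟩ | ⟨hM, h⟩) (⟨hN, k⟩ | ⟨hN, k⟩)
        · exact Or.inl ⟨hM, D.left.trans' h k⟩
        · exact absurd (hl _ _ h hM) hN
        · exact absurd (hr _ _ (D.right.symm' h) hN) hM
        · exact Or.inr ⟨hM, D.right.trans' h k⟩ }

theorem blend_isCliffordLike (S : Set (ProjLine F V))
    (hl : ∀ M N, D.left M N → M ∈ S → N ∈ S) (hr : ∀ M N, D.right M N → M ∈ S → N ∈ S) :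
    D.IsCliffordLike (D.blend S hl hr) := by
  refine ⟨fun q M => ?_, fun M N h => h.imp And.right And.right⟩
  by_cases hM : M ∈ S
  · have hc : ∀ N, D.blend S hl hr M N ↔ D.left M N := fun N =>
      ⟨fun h => h.elim And.right (fun h => absurd hM h.1), fun h => Or.inl ⟨hM, h⟩⟩
    simpa only [hc] using D.left_isParallelism q M
  · have hc : ∀ N, D.blend S hl hr M N ↔ D.right M N := fun N =>
      ⟨fun h => h.elim (fun h => absurd h.1 hM) And.right, fun h => Or.inr ⟨hM, h⟩⟩
    simpa only [hc] using D.right_isParallelism q M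

/-- If left and right parallelism commute and no left class is a right class, then the two are the
only Clifford-like parallelisms precisely when any two lines are linked by a left parallelism
followed by a right parallelism. -/
theorem setOf_isCliffordLike_eq_iff
    (hcomm : ∀ M N P, D.left M N → D.right N P → ∃ Q, D.right M Q ∧ D.left Q P)
    (hne : ∀ M, ∃ N, ¬(D.left M N ↔ D.right M N)) :
    {s | D.IsCliffordLike s} = {D.left, D.right} ↔
      ∀ M N, ∃ P, D.left M P ∧ D.right P N := by
  constructor
  · intro h M₀ N₀
    by_contra hN₀
    have hl : ∀ M N, D.left M N → (∃ P, D.left M₀ P ∧ D.right P M) →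
        ∃ P, D.left M₀ P ∧ D.right P N := by
      rintro M N hMN ⟨P, h1, h2⟩
      obtain ⟨Q, h3, h4⟩ := hcomm N M P (D.left.symm' hMN) (D.right.symm' h2)
      exact ⟨Q, D.left.trans' h1 (D.left.symm' h4), D.right.symm' h3⟩
    have hr : ∀ M N, D.right M N → (∃ P, D.left M₀ P ∧ D.right P M) →
        ∃ P, D.left M₀ P ∧ D.right P N :=
      fun M N hMN ⟨P, h1, h2⟩ => ⟨P, h1, D.right.trans' h2 hMN⟩
    -- Left parallelism on the lines linked to `M₀` and right parallelism elsewhere is a third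
    -- Clifford-like parallelism.
    have hmem : D.blend {M | ∃ P, D.left M₀ P ∧ D.right P M} hl hr ∈
        ({D.left, D.right} : Set _) := h ▸ blend_isCliffordLike _ hl hr
    rcases hmem with heq | heq
    · obtain ⟨N, hN⟩ := hne N₀
      refine hN ?_
      rw [← heq]
      exact ⟨fun h => h.elim (fun h => absurd h.1 hN₀) And.right, fun h => Or.inr ⟨hN₀, h⟩⟩
    · obtain ⟨N, hN⟩ := hne M₀
      have hM₀ : ∃ P, D.left M₀ P ∧ D.right P M₀ := ⟨M₀, D.left.refl' _, D.right.refl' _⟩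
      refine hN ?_
      rw [← heq]
      exact ⟨fun h => Or.inl ⟨hM₀, h⟩, fun h => h.elim And.right (fun h => absurd hM₀ h.1)⟩
  · intro h
    ext s
    simp only [Set.mem_ofPred_eq, Set.mem_insert_iff, Set.mem_singleton_iff]
    constructor
    · intro hs
      by_cases hall : ∀ M N, s M N ↔ D.left M N
      · exact Or.inl (Setoid.ext hall)
      right
      by_contra hsr
      have hall' : ¬ ∀ M N, s M N ↔ D.right M N := fun h => hsr (Setoid.ext h)
      push Not at hall hall'
      obtain ⟨N, N₁, hN⟩ := hall
      obtain ⟨M, M₁, hM⟩ := hall'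
      have hMl := (hs.class_eq M).resolve_right fun h => by have := h M₁; tauto
      have hNr := (hs.class_eq N).resolve_left fun h => by have := h N₁; tauto
      -- The left class of `M` and the right class of `N` are classes of `s` that share `P`.
      obtain ⟨P, hMP, hPN⟩ := h M N
      have h1 := (hMl P).2 hMP
      have h2 := (hNr P).2 (D.right.symm' hPN)
      obtain ⟨Q, hQ⟩ := hne P
      refine hQ ⟨fun hl => ?_, fun hr => ?_⟩
      · have h3 := (hMl Q).2 (D.left.trans' hMP hl)
        exact D.right.trans' hPN
          ((hNr Q).1 (s.trans' h2 (s.trans' (s.symm' h1) h3)))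
      · have h3 := (hNr Q).2 (D.right.trans' (D.right.symm' hPN) hr)
        exact D.left.trans' (D.left.symm' hMP)
          ((hMl Q).1 (s.trans' h1 (s.trans' (s.symm' h2) h3)))
    · rintro (rfl | rfl)
      · exact ⟨D.left_isParallelism, fun _ _ => Or.inl⟩
      · exact ⟨D.right_isParallelism, fun _ _ => Or.inr⟩

end ProjectiveDoubleSpace

end DoubleSpace

/-! ### Maximal subfields of a quaternion skew field -/

section Subfields

open Algebra

variable {F H : Type*} [Field F] [DivisionRing H] [Algebra F H]

theorem linearIndependent_one_of_notMem_bot {g : H} (hg : g ∉ (⊥ : Subalgebra F H)) :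
    LinearIndependent F ![(1 : H), g] := by
  rw [LinearIndependent.pair_iff' one_ne_zero]
  intro c hc
  exact hg (Algebra.mem_bot.2 ⟨c, by rw [← hc, Algebra.smul_def, mul_one]⟩)

theorem finrank_span_one_of_notMem_bot {g : H} (hg : g ∉ (⊥ : Subalgebra F H)) :
    Module.finrank F (Submodule.span F {1, g}) = 2 := by
  have := finrank_span_eq_card (linearIndependent_one_of_notMem_bot hg)
  rwa [Matrix.range_cons, Matrix.range_cons, Matrix.range_empty, Set.union_empty,
    Set.singleton_union, Fintype.card_fin] at this

theorem eq_zero_of_smul_one_add_smul_eq_zero {g : H} (hg : g ∉ (⊥ : Subalgebra F H)) {x y : F}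
    (h : x • (1 : H) + y • g = 0) : x = 0 ∧ y = 0 :=
  (linearIndependent_one_of_notMem_bot hg).eq_zero_of_pair h

theorem smul_one_mem_bot (x : F) : x • (1 : H) ∈ (⊥ : Subalgebra F H) :=
  Subalgebra.smul_mem _ (one_mem _) x

/-- A line through `1` is spanned by `1` and any noncentral element of it. -/
theorem ProjLine.eq_span_one {L : ProjLine F H} (h1 : (1 : H) ∈ L.1) {g : H} (hgL : g ∈ L.1)
    (hg : g ∉ (⊥ : Subalgebra F H)) : L.1 = Submodule.span F {1, g} := by
  have : FiniteDimensional F L.1 := Module.finite_of_finrank_pos (by rw [L.2]; omega)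
  symm
  apply Submodule.eq_of_le_of_finrank_eq
  · rw [Submodule.span_le]
    rintro x (rfl | rfl)
    · exact h1
    · exact hgL
  · rw [L.2, finrank_span_one_of_notMem_bot hg]

theorem ProjLine.exists_mem_notMem_bot (L : ProjLine F H) :
    ∃ g ∈ L.1, g ∉ (⊥ : Subalgebra F H) := by
  by_contra hcon
  push Not at hcon
  have hle : L.1 ≤ Subalgebra.toSubmodule (⊥ : Subalgebra F H) := fun x hx => hcon x hx
  have : Module.Finite F (Subalgebra.toSubmodule (⊥ : Subalgebra F H)) :=
    Subalgebra.finite_bot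
  have := Submodule.finrank_mono hle
  rw [Subalgebra.finrank_toSubmodule, Subalgebra.finrank_bot, L.2] at this
  omega

theorem exists_notMem_bot (h4 : Module.finrank F H = 4) : ∃ g : H, g ∉ (⊥ : Subalgebra F H) := by
  by_contra hcon
  push Not at hcon
  have : (⊥ : Subalgebra F H) = ⊤ := by
    rw [_root_.eq_top_iff]; exact fun x _ => hcon x
  rw [Subalgebra.bot_eq_top_iff_finrank_eq_one] at this
  omega

theorem exists_mul_ne_of_notMem_bot [IsCentral F H] {g : H} (hg : g ∉ (⊥ : Subalgebra F H)) :
    ∃ c : H, c * g ≠ g * c := by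
  by_contra hcon
  push Not at hcon
  exact hg (IsCentral.out (Subalgebra.mem_center_iff.2 hcon))

/-- A proper subalgebra has dimension `1` or `2`, since its dimension divides `4`. -/
theorem Subalgebra.toSubmodule_eq_span_one (h4 : Module.finrank F H = 4) {S : Subalgebra F H}
    (hS : S ≠ ⊤) {g : H} (hgS : g ∈ S) (hg : g ∉ (⊥ : Subalgebra F H)) :
    Subalgebra.toSubmodule S = Submodule.span F {1, g} := by
  have : FiniteDimensional F H := Module.finite_of_finrank_pos (by omega)
  have hle : Submodule.span F {1, g} ≤ Subalgebra.toSubmodule S := by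
    rw [Submodule.span_le]
    rintro x (rfl | rfl)
    · exact S.one_mem
    · exact hgS
  symm
  apply Submodule.eq_of_le_of_finrank_eq hle
  have hge := Submodule.finrank_mono hle
  rw [finrank_span_one_of_notMem_bot hg, Subalgebra.finrank_toSubmodule] at hge
  rw [finrank_span_one_of_notMem_bot hg, Subalgebra.finrank_toSubmodule]
  let _ : DivisionRing S := divisionRingOfFiniteDimensional F S
  have hmul : Module.finrank F S * Module.finrank S H = 4 := by
    rw [← h4]; exact Module.finrank_mul_finrank F S H
  have hdvd : Module.finrank F S ∣ 4 := ⟨_, hmul.symm⟩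
  have hle := Nat.le_of_dvd (by norm_num) hdvd
  have hne : Module.finrank F S ≠ 4 := by
    intro h
    apply hS
    apply Subalgebra.eq_of_le_of_finrank_eq le_top
    rw [h, ← h4]
    exact (Subalgebra.topEquiv (R := F) (A := H)).toLinearEquiv.finrank_eq.symm
  interval_cases hh : Module.finrank F S
  · rfl
  · omega
  · exact absurd rfl hne

theorem adjoin_singleton_ne_top [IsCentral F H] {g : H} (hg : g ∉ (⊥ : Subalgebra F H)) :
    adjoin F {g} ≠ ⊤ := by
  intro htop
  obtain ⟨c, hc⟩ := exists_mul_ne_of_notMem_bot hg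
  exact hc (commute_of_mem_adjoin_self (htop ▸ Algebra.mem_top)).symm

theorem toSubmodule_adjoin_singleton [IsCentral F H] (h4 : Module.finrank F H = 4) {g : H}
    (hg : g ∉ (⊥ : Subalgebra F H)) :
    Subalgebra.toSubmodule (adjoin F {g}) = Submodule.span F {1, g} :=
  Subalgebra.toSubmodule_eq_span_one h4 (adjoin_singleton_ne_top hg) (self_mem_adjoin_singleton F g)
    hg

theorem mem_adjoin_singleton_iff [IsCentral F H] (h4 : Module.finrank F H = 4) {g x : H}
    (hg : g ∉ (⊥ : Subalgebra F H)) :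
    x ∈ adjoin F {g} ↔ ∃ a b : F, a • (1 : H) + b • g = x := by
  rw [← Submodule.mem_span_pair, ← toSubmodule_adjoin_singleton h4 hg,
    Subalgebra.mem_toSubmodule]

/-- Every noncentral element satisfies a quadratic equation over `F`. -/
theorem exists_mul_self_eq [IsCentral F H] (h4 : Module.finrank F H = 4) {g : H}
    (hg : g ∉ (⊥ : Subalgebra F H)) : ∃ t n : F, g * g = t • g + n • (1 : H) := by
  have := self_mem_adjoin_singleton F g
  obtain ⟨a, b, h⟩ := (mem_adjoin_singleton_iff h4 hg).1 (mul_mem this this)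
  exact ⟨b, a, by rw [← h, add_comm]⟩

/-- The maximal subfields are the algebras generated by one noncentral element. -/
theorem isMaximalSubfield_iff [IsCentral F H] (h4 : Module.finrank F H = 4)
    {K : Subalgebra F H} :
    IsMaximalSubfield F H K ↔ ∃ g ∉ (⊥ : Subalgebra F H), K = adjoin F {g} := by
  have : FiniteDimensional F H := Module.finite_of_finrank_pos (by omega)
  have key : ∀ g ∉ (⊥ : Subalgebra F H), IsMaximalSubfield F H (adjoin F {g}) := by
    intro g hg
    refine ⟨⟨⟨0, 1, zero_ne_one⟩, ?_, ?_⟩, ?_⟩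
    · intro x y
      apply Subtype.ext
      obtain ⟨a, b, h⟩ := (mem_adjoin_singleton_iff h4 hg).1 y.2
      have hx := commute_of_mem_adjoin_self x.2
      change (x : H) * y = y * x
      rw [← h]
      exact (((Commute.one_left _).smul_left a).add_left (hx.smul_left b)).symm
    · intro x hx
      exact FiniteDimensional.exists_mul_eq_one F hx
    · intro S hS hle
      have hgS : g ∈ S := hle (self_mem_adjoin_singleton F g)
      have hne : S ≠ ⊤ := by
        rintro rfl
        obtain ⟨c, hc⟩ := exists_mul_ne_of_notMem_bot hg
        exact hc (congrArg Subtype.val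
          (hS.mul_comm (⟨c, Algebra.mem_top⟩ : (⊤ : Subalgebra F H)) ⟨g, Algebra.mem_top⟩))
      change Subalgebra.toSubmodule S ≤ Subalgebra.toSubmodule (adjoin F {g})
      rw [toSubmodule_adjoin_singleton h4 hg, Subalgebra.toSubmodule_eq_span_one h4 hne hgS hg]
  refine ⟨fun hK => ?_, fun ⟨g, hg, h⟩ => h ▸ key g hg⟩
  by_cases hKb : K ≤ ⊥
  · obtain ⟨g, hg⟩ := exists_notMem_bot h4
    have hle : K ≤ adjoin F {g} := hKb.trans bot_le
    exact absurd (hKb (hK.2 (key g hg).1 hle (self_mem_adjoin_singleton F g))) hg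
  · obtain ⟨g, hgK, hg⟩ := SetLike.not_le_iff_exists.1 hKb
    have hle : adjoin F {g} ≤ K := adjoin_le (by simpa using hgK)
    exact ⟨g, hg, le_antisymm ((key g hg).2 hK.1 hle) hle⟩

/-- The centralizer of a noncentral element `g` is `F(g)`. -/
theorem mem_adjoin_singleton_of_commute [IsCentral F H] (h4 : Module.finrank F H = 4) {g x : H}
    (hg : g ∉ (⊥ : Subalgebra F H)) (hx : g * x = x * g) : x ∈ adjoin F {g} := by
  have hmem : ∀ z, z ∈ Subalgebra.centralizer F {g} ↔ g * z = z * g := by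
    simp [Subalgebra.mem_centralizer_iff]
  have hne : Subalgebra.centralizer F {g} ≠ ⊤ := by
    intro htop
    obtain ⟨c, hc⟩ := exists_mul_ne_of_notMem_bot hg
    exact hc ((hmem c).1 (htop ▸ Algebra.mem_top)).symm
  have := Subalgebra.toSubmodule_eq_span_one h4 hne ((hmem g).2 rfl) hg
  rw [← Subalgebra.mem_toSubmodule, toSubmodule_adjoin_singleton h4 hg, ← this]
  exact (hmem x).2 hx

/-- An element `g` generating a separable quadratic extension has an `h` that conjugates `g` to
its other root `t - g`; the square of such an `h` is central. -/
theorem exists_conjugating_element [IsCentral F H] (h4 : Module.finrank F H = 4) {g : H} {t n : F}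
    (hg : g ∉ (⊥ : Subalgebra F H)) (hq : g * g = t • g + n • (1 : H))
    (hsep : (2 : H) * g ≠ t • (1 : H)) :
    ∃ h : H, h ∉ (⊥ : Subalgebra F H) ∧ h * g = t • h - g * h ∧ ∃ b : F, h * h = b • (1 : H) := by
  obtain ⟨c, hc⟩ := exists_mul_ne_of_notMem_bot hg
  have h0 : c * g - g * c ≠ 0 := sub_ne_zero.2 hc
  have hconj : (c * g - g * c) * g = t • (c * g - g * c) - g * (c * g - g * c) := by
    have e1 : c * (g * g) = t • (c * g) + n • c := by
      rw [hq, mul_add, mul_smul_comm, mul_smul_comm, mul_one]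
    have e2 : g * (g * c) = t • (g * c) + n • c := by
      rw [← mul_assoc, hq, add_mul, smul_mul_assoc, smul_mul_assoc, one_mul]
    rw [sub_mul, mul_sub, mul_assoc, mul_assoc, e1, e2, smul_sub]
    abel
  generalize c * g - g * c = h at h0 hconj
  have hncomm : g * h ≠ h * g := by
    intro hcomm
    apply hsep
    apply mul_right_cancel₀ h0
    rw [← hcomm] at hconj
    rw [two_mul, add_mul, smul_mul_assoc, one_mul]
    nth_rewrite 1 [hconj]
    abel
  have hbot : ∀ z ∈ (⊥ : Subalgebra F H), ∀ y, z * y = y * z := by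
    intro z hz y
    obtain ⟨r, rfl⟩ := Algebra.mem_bot.1 hz
    exact Algebra.commutes r y
  refine ⟨h, fun hb => hncomm (hbot h hb g).symm, hconj, ?_⟩
  have hsq : g * (h * h) = h * h * g := by
    rw [mul_assoc h h g, hconj, mul_sub, mul_smul_comm, ← mul_assoc h g h, hconj, sub_mul,
      smul_mul_assoc, mul_assoc]
    abel
  obtain ⟨a, b, hab⟩ := (mem_adjoin_singleton_iff h4 hg).1
    (mem_adjoin_singleton_of_commute h4 hg hsq)
  by_cases hb : b = 0
  · exact ⟨a, by rw [← hab, hb, zero_smul, add_zero]⟩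
  · -- `h` commutes with `h * h = a + b g`, so it would commute with `g`.
    exfalso
    apply hncomm
    have := mul_assoc h h h
    rw [← hab, add_mul, mul_add, smul_mul_assoc, mul_smul_comm, one_mul, mul_one,
      add_right_inj, smul_mul_assoc, mul_smul_comm] at this
    exact smul_right_injective H hb this

end Subfields

/-! ### Isomorphic maximal subfields -/

section Isomorphic

open Algebra

variable {F H : Type*} [Field F] [DivisionRing H] [Algebra F H]

theorem mul_comm_of_mem_bot {z : H} (hz : z ∈ (⊥ : Subalgebra F H)) (y : H) : z * y = y * z := by
  obtain ⟨r, rfl⟩ := Algebra.mem_bot.1 hz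
  exact Algebra.commutes r y

theorem mem_bot_of_smul_mem_bot {g : H} {y : F} (hy : y ≠ 0)
    (h : y • g ∈ (⊥ : Subalgebra F H)) : g ∈ (⊥ : Subalgebra F H) := by
  have := Subalgebra.smul_mem _ h y⁻¹
  rwa [smul_smul, inv_mul_cancel₀ hy, one_smul] at this

theorem smul_one_add_smul_mul_self (x y : F) (h : H) :
    (x • (1 : H) + y • h) * (x • (1 : H) + y • h) =
      (x * x) • (1 : H) + (2 * x * y) • h + (y * y) • (h * h) := by
  simp only [mul_add, add_mul, smul_mul_smul_comm, one_mul, mul_one]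
  module

variable [IsCentral F H]

/-- If `F(g)` and `F(h)` are isomorphic, then `F(h)` has a generator with the same quadratic
equation as `g`. -/
theorem exists_same_quadratic (h4 : Module.finrank F H = 4)
    (hiso : ∀ K L : Subalgebra F H, IsMaximalSubfield F H K → IsMaximalSubfield F H L →
      Nonempty (K ≃ₐ[F] L))
    {g h : H} (hg : g ∉ (⊥ : Subalgebra F H)) (hh : h ∉ (⊥ : Subalgebra F H)) {t n : F}
    (hq : g * g = t • g + n • (1 : H)) :
    ∃ x y : F, y ≠ 0 ∧ (x • (1 : H) + y • h) * (x • (1 : H) + y • h) =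
      t • (x • (1 : H) + y • h) + n • (1 : H) := by
  obtain ⟨φ⟩ := hiso (adjoin F {g}) (adjoin F {h}) ((isMaximalSubfield_iff h4).2 ⟨g, hg, rfl⟩)
    ((isMaximalSubfield_iff h4).2 ⟨h, hh, rfl⟩)
  let g' : adjoin F {g} := ⟨g, self_mem_adjoin_singleton F g⟩
  obtain ⟨x, y, hxy⟩ := (mem_adjoin_singleton_iff h4 hh).1 (φ g').2
  refine ⟨x, y, ?_, ?_⟩
  · rintro rfl
    have hx : φ g' = φ (algebraMap F _ x) := by
      apply Subtype.ext
      rw [← hxy, AlgEquiv.commutes, zero_smul, add_zero, Subalgebra.coe_algebraMap,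
        Algebra.smul_def, mul_one]
    exact hg (Algebra.mem_bot.2 ⟨x, (congrArg Subtype.val (φ.injective hx)).symm⟩)
  · have hg' : g' * g' = t • g' + n • 1 := Subtype.ext hq
    have := congrArg (fun z => (φ z : H)) hg'
    simp only [map_mul, map_add, map_smul, map_one] at this
    rw [hxy]
    exact this

/-- In characteristic two `H` has both separable and inseparable maximal subfields. -/
theorem two_ne_zero_of_isomorphic (h4 : Module.finrank F H = 4)
    (hiso : ∀ K L : Subalgebra F H, IsMaximalSubfield F H K → IsMaximalSubfield F H L →
      Nonempty (K ≃ₐ[F] L)) : (2 : F) ≠ 0 := by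
  intro h2
  have h2' : (2 : H) = 0 := by
    rw [← map_ofNat (algebraMap F H) 2, h2, map_zero]
  by_cases hall : ∀ g : H, g * g ∈ (⊥ : Subalgebra F H)
  · -- If all squares are central, then so are all `g c + c g`, in particular `(g c + c g) c`.
    have hpol : ∀ g c : H, g * c + c * g ∈ (⊥ : Subalgebra F H) := by
      intro g c
      have : g * c + c * g = (g + c) * (g + c) - g * g - c * c := by
        simp only [mul_add, add_mul]; abel
      rw [this]
      exact sub_mem (sub_mem (hall _) (hall _)) (hall _)
    obtain ⟨g, hg⟩ := exists_notMem_bot h4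
    obtain ⟨c, hc⟩ := exists_mul_ne_of_notMem_bot hg
    obtain ⟨s, hs⟩ := Algebra.mem_bot.1 (hpol g c)
    have hs0 : s ≠ 0 := by
      rintro rfl
      rw [map_zero] at hs
      apply hc
      have h0 : c * g + c * g = 0 := by rw [← two_mul, h2', zero_mul]
      exact add_right_cancel ((h0.trans hs))
    have h3 : s • c ∈ (⊥ : Subalgebra F H) := by
      have := hpol (g * c) c
      rwa [← mul_assoc c, ← add_mul, ← hs, ← Algebra.smul_def] at this
    exact hc (mul_comm_of_mem_bot (mem_bot_of_smul_mem_bot hs0 h3) g)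
  · push Not at hall
    obtain ⟨g, hgg⟩ := hall
    have hg : g ∉ (⊥ : Subalgebra F H) := fun h => hgg (mul_mem h h)
    obtain ⟨t, n, hq⟩ := exists_mul_self_eq h4 hg
    have ht : t ≠ 0 := by
      rintro rfl
      rw [zero_smul, zero_add] at hq
      exact hgg (hq ▸ smul_one_mem_bot n)
    obtain ⟨h, hh, -, b, hb⟩ := exists_conjugating_element h4 hg hq (by
      rw [h2', zero_mul]
      exact (smul_ne_zero ht one_ne_zero).symm)
    obtain ⟨x, y, hy, hxy⟩ := exists_same_quadratic h4 hiso hh hg (t := 0) (n := b)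
      (by rw [hb, zero_smul, zero_add])
    rw [smul_one_add_smul_mul_self, hq, h2] at hxy
    have h0 : (x * x + y * y * n - b) • (1 : H) + (y * y * t) • g = 0 := by
      rw [← sub_eq_zero] at hxy
      rw [← hxy]
      module
    exact mul_ne_zero (mul_ne_zero hy hy) ht (eq_zero_of_smul_one_add_smul_eq_zero hg h0).2

/-- Pure quaternions generating isomorphic subfields have squares in the same square class. -/
theorem exists_eq_mul_self_mul (h4 : Module.finrank F H = 4)
    (hiso : ∀ K L : Subalgebra F H, IsMaximalSubfield F H K → IsMaximalSubfield F H L →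
      Nonempty (K ≃ₐ[F] L))
    {g h : H} (hg : g ∉ (⊥ : Subalgebra F H)) (hh : h ∉ (⊥ : Subalgebra F H)) {a b : F}
    (ha : g * g = a • (1 : H)) (hb : h * h = b • (1 : H)) : ∃ y : F, y ≠ 0 ∧ a = y * y * b := by
  obtain ⟨x, y, hy, hxy⟩ := exists_same_quadratic h4 hiso hg hh (t := 0) (n := a)
    (by rw [ha, zero_smul, zero_add])
  rw [smul_one_add_smul_mul_self, hb] at hxy
  have h0 : (x * x + y * y * b - a) • (1 : H) + (2 * x * y) • h = 0 := by
    rw [← sub_eq_zero] at hxy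
    rw [← hxy]
    module
  obtain ⟨h1, h2⟩ := eq_zero_of_smul_one_add_smul_eq_zero hh h0
  have hx : x = 0 := by
    simpa [two_ne_zero_of_isomorphic h4 hiso, hy] using h2
  refine ⟨y, hy, ?_⟩
  rw [hx] at h1
  linear_combination -h1

theorem exists_anticommuting_mul_self_eq_neg_one (h4 : Module.finrank F H = 4)
    (hiso : ∀ K L : Subalgebra F H, IsMaximalSubfield F H K → IsMaximalSubfield F H L →
      Nonempty (K ≃ₐ[F] L)) :
    ∃ i j : H, i ∉ (⊥ : Subalgebra F H) ∧ i * i = -1 ∧ j * j = -1 ∧ j * i = -(i * j) := by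
  have h2 := two_ne_zero_of_isomorphic h4 hiso
  have h2' : (2 : H) ≠ 0 := by
    rw [← map_ofNat (algebraMap F H) 2]
    exact (map_ne_zero _).2 h2
  obtain ⟨g₀, hg₀⟩ := exists_notMem_bot h4
  obtain ⟨t, n, hq⟩ := exists_mul_self_eq h4 hg₀
  obtain ⟨g, hg, a, ha⟩ : ∃ g ∉ (⊥ : Subalgebra F H), ∃ a : F, g * g = a • (1 : H) := by
    refine ⟨(-t / 2) • (1 : H) + (1 : F) • g₀, fun hmem => hg₀ ?_, (-t / 2) * (-t / 2) + n, ?_⟩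
    · have := sub_mem hmem (smul_one_mem_bot (-t / 2))
      rwa [add_sub_cancel_left, one_smul] at this
    · rw [smul_one_add_smul_mul_self, hq]
      match_scalars <;> field_simp
      ring
  have hg0 : g ≠ 0 := by rintro rfl; exact hg (zero_mem _)
  obtain ⟨h, hh, hanti, b, hb⟩ := exists_conjugating_element h4 hg (t := 0) (n := a)
    (by rw [ha, zero_smul, zero_add]) (by rw [zero_smul]; exact mul_ne_zero h2' hg0)
  rw [zero_smul, zero_sub] at hanti
  have hh0 : h ≠ 0 := by rintro rfl; exact hh (zero_mem _)
  have hb0 : b ≠ 0 := by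
    rintro rfl
    rw [zero_smul] at hb
    exact mul_ne_zero hh0 hh0 hb
  have hk : g * h ∉ (⊥ : Subalgebra F H) := by
    intro hmem
    have := mul_comm_of_mem_bot hmem g
    rw [mul_assoc, hanti, mul_neg, neg_eq_iff_add_eq_zero, ← two_mul] at this
    exact mul_ne_zero h2' (mul_ne_zero hg0 (mul_ne_zero hg0 hh0)) this
  have hkk : g * h * (g * h) = (-(a * b)) • (1 : H) := by
    rw [mul_assoc, ← mul_assoc h, hanti, neg_mul, mul_neg, mul_assoc g h h, ← mul_assoc g g, ha,
      hb, smul_mul_smul_comm, one_mul, neg_smul]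
  obtain ⟨y, hy, hyb⟩ := exists_eq_mul_self_mul h4 hiso hh hk hb hkk
  obtain ⟨z, hz, hza⟩ := exists_eq_mul_self_mul h4 hiso hg hh ha hb
  have hya : y * y * a = -1 := by
    apply mul_right_cancel₀ hb0
    linear_combination hyb
  refine ⟨y • g, (y * z) • h, fun hmem => hg (mem_bot_of_smul_mem_bot hy hmem), ?_, ?_, ?_⟩
  · rw [smul_mul_smul_comm, ha, smul_smul, hya, neg_one_smul]
  · rw [smul_mul_smul_comm, hb, smul_smul, ← neg_one_smul F (1 : H)]
    congr 1
    linear_combination hya - y * y * hza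
  · rw [smul_mul_smul_comm, smul_mul_smul_comm, hanti, smul_neg]
    congr 2
    ring

theorem quaternion_of_isomorphic (h4 : Module.finrank F H = 4)
    (hiso : ∀ K L : Subalgebra F H, IsMaximalSubfield F H K → IsMaximalSubfield F H L →
      Nonempty (K ≃ₐ[F] L)) :
    (IsFormallyRealField F ∧ IsPythagoreanField F) ∧ IsOrdinaryQuaternionSkewField F H := by
  have : FiniteDimensional F H := Module.finite_of_finrank_pos (by omega)
  have h2 := two_ne_zero_of_isomorphic h4 hiso
  have h2' : (2 : H) ≠ 0 := by
    rw [← map_ofNat (algebraMap F H) 2]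
    exact (map_ne_zero _).2 h2
  obtain ⟨i, j, hi, hii, hjj, hji⟩ := exists_anticommuting_mul_self_eq_neg_one h4 hiso
  have hi0 : i ≠ 0 := by rintro rfl; exact hi (zero_mem _)
  have hj0 : j ≠ 0 := by rintro rfl; simp at hjj
  refine ⟨⟨?_, ?_⟩, ?_⟩
  · rintro ⟨r, hr⟩
    have hfac : (i - algebraMap F H r) * (i + algebraMap F H r) = 0 := by
      rw [mul_add, sub_mul, sub_mul, ← Algebra.commutes r i, ← map_mul, ← hr, hii, map_neg,
        map_one]
      abel
    rcases mul_eq_zero.1 hfac with h | h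
    · exact hi (Algebra.mem_bot.2 ⟨r, (sub_eq_zero.1 h).symm⟩)
    · exact hi (Algebra.mem_bot.2 ⟨-r, by rw [map_neg, ← eq_neg_of_add_eq_zero_left h]⟩)
  · intro x y
    by_cases hy : y = 0
    · exact ⟨x, by rw [hy]; ring⟩
    have hu : x • i + y • j ∉ (⊥ : Subalgebra F H) := by
      intro hmem
      have := mul_comm_of_mem_bot hmem i
      rw [add_mul, mul_add, smul_mul_assoc, smul_mul_assoc, mul_smul_comm, mul_smul_comm,
        add_right_inj, hji, smul_neg, neg_eq_iff_add_eq_zero, ← two_mul] at this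
      exact mul_ne_zero h2' (smul_ne_zero hy (mul_ne_zero hi0 hj0)) this
    have huu : (x • i + y • j) * (x • i + y • j) = (-(x ^ 2 + y ^ 2)) • (1 : H) := by
      simp only [mul_add, add_mul, smul_mul_smul_comm, hii, hjj, hji]
      module
    obtain ⟨s, -, hs⟩ := exists_eq_mul_self_mul h4 hiso hu hi huu (b := -1)
      (by rw [hii, neg_one_smul])
    exact ⟨s, by linear_combination -hs⟩
  · let B : QuaternionAlgebra.Basis H (-1 : F) 0 (-1) :=
      { i := i, j := j, k := i * j
        i_mul_i := by rw [hii, neg_one_smul, zero_smul, add_zero]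
        j_mul_j := by rw [hjj, neg_one_smul]
        i_mul_j := rfl
        j_mul_i := by rw [hji, zero_smul, zero_sub] }
    let φ : Quaternion F →ₐ[F] H := QuaternionAlgebra.lift B
    have hφ : ∀ q : Quaternion F, φ q = (q.re • (1 : H) + q.imI • i) +
        (q.imJ • (1 : H) + q.imK • i) * j := by
      intro q
      change algebraMap F H q.re + q.imI • i + q.imJ • j + q.imK • (i * j) = _
      rw [Algebra.algebraMap_eq_smul_one, add_mul, smul_mul_assoc,
        smul_mul_assoc, one_mul]
      abel
    have hinj : Function.Injective φ := by
      rw [injective_iff_map_eq_zero]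
      intro q hq
      rw [hφ] at hq
      -- The commutator with `i` kills the first summand and doubles the second.
      have hcom : 2 * (i * ((q.imJ • (1 : H) + q.imK • i) * j)) = 0 := by
        have h0 : ∀ p r : H, p + r = 0 → i * p = p * i → r * i = -(i * r) →
            2 * (i * r) = 0 := by
          intro p r h1 h3 h5
          have h6 : i * (p + r) - (p + r) * i = 0 := by rw [h1]; simp
          rw [mul_add, add_mul, h3, h5] at h6
          rw [← h6, two_mul]
          abel
        refine h0 _ _ hq ?_ ?_
        · simp only [mul_add, add_mul, mul_smul_comm, smul_mul_assoc, one_mul, mul_one]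
        · rw [mul_assoc, hji, mul_neg, ← mul_assoc, ← mul_assoc]
          simp only [mul_add, add_mul, mul_smul_comm, smul_mul_assoc, one_mul, mul_one]
      have hr : q.imJ • (1 : H) + q.imK • i = 0 := by
        simpa [h2', hi0, hj0] using hcom
      rw [hr, zero_mul, add_zero] at hq
      obtain ⟨e1, e2⟩ := eq_zero_of_smul_one_add_smul_eq_zero hi hq
      obtain ⟨e3, e4⟩ := eq_zero_of_smul_one_add_smul_eq_zero hi hr
      exact QuaternionAlgebra.ext e1 e2 e3 e4
    have hsurj : Function.Surjective φ :=
      (LinearMap.injective_iff_surjective_of_finrank_eq_finrank (f := φ.toLinearMap)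
        (Quaternion.finrank_eq_four.trans h4.symm)).1 hinj
    exact ⟨(AlgEquiv.ofBijective φ ⟨hinj, hsurj⟩).symm⟩

end Isomorphic

/-! ### Conjugacy of the lines through `1` -/

section Conjugacy

open Algebra

variable {F H : Type*} [Field F] [DivisionRing H] [Algebra F H]

theorem exists_leftParallel_one_mem (M : ProjLine F H) :
    ∃ L : ProjLine F H, leftParallel F H M L ∧ (1 : H) ∈ L.1 := by
  obtain ⟨m, hm, hm0⟩ := M.exists_mem_notMem_bot
  have hm0 : m ≠ 0 := by rintro rfl; exact hm0 (zero_mem _)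
  exact ⟨⟨_, (finrank_map_mulLeft (inv_ne_zero hm0) M.1).trans M.2⟩, ⟨_, inv_ne_zero hm0, rfl⟩,
    m, hm, inv_mul_cancel₀ hm0⟩

theorem exists_rightParallel_one_mem (M : ProjLine F H) :
    ∃ L : ProjLine F H, rightParallel F H M L ∧ (1 : H) ∈ L.1 := by
  obtain ⟨m, hm, hm0⟩ := M.exists_mem_notMem_bot
  have hm0 : m ≠ 0 := by rintro rfl; exact hm0 (zero_mem _)
  exact ⟨⟨_, (finrank_map_mulRight (inv_ne_zero hm0) M.1).trans M.2⟩, ⟨_, inv_ne_zero hm0, rfl⟩,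
    m, hm, mul_inv_cancel₀ hm0⟩

theorem leftParallel_rightParallel_comm (M N P : ProjLine F H) (hl : leftParallel F H M N)
    (hr : rightParallel F H N P) : ∃ Q, rightParallel F H M Q ∧ leftParallel F H Q P := by
  obtain ⟨c, hc, h⟩ := hl
  obtain ⟨d, hd, k⟩ := hr
  refine ⟨⟨_, (finrank_map_mulRight hd M.1).trans M.2⟩, ⟨d, hd, rfl⟩, c, hc, ?_⟩
  rw [← k, ← h, ← Submodule.map_comp, ← Submodule.map_comp]
  congr 1
  ext x
  exact (mul_assoc c x d).symm

/-- No left class is a right class. Otherwise some `L = F(g)` would satisfy `x L = L x` for all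
`x`, as both lines are right parallel to `L` and contain `x`; comparing `x` with `1 + x` shows
that such an `L` is central, as in the Cartan–Brauer–Hua theorem. -/
theorem exists_not_leftParallel_iff_rightParallel [IsCentral F H] (h4 : Module.finrank F H = 4)
    (M : ProjLine F H) : ∃ N, ¬(leftParallel F H M N ↔ rightParallel F H M N) := by
  by_contra hcon
  push Not at hcon
  obtain ⟨L, hML, h1⟩ := exists_leftParallel_one_mem M
  obtain ⟨g, hgL, hg⟩ := L.exists_mem_notMem_bot
  have hspan := L.eq_span_one h1 hgL hg
  obtain ⟨x, hx⟩ := exists_mul_ne_of_notMem_bot hg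
  have hnorm : ∀ y : H, y ≠ 0 → ∃ g' ∈ L.1, y * g = g' * y := by
    intro y hy
    let N₁ : ProjLine F H := ⟨_, (finrank_map_mulLeft hy L.1).trans L.2⟩
    let N₂ : ProjLine F H := ⟨_, (finrank_map_mulRight hy L.1).trans L.2⟩
    have hL₁ : leftParallel F H L N₁ := ⟨y, hy, rfl⟩
    have hL₂ : rightParallel F H L N₂ := ⟨y, hy, rfl⟩
    have hr : rightParallel F H L N₁ :=
      (rightParallel F H).trans' ((rightParallel F H).symm' ((hcon L).1 hML))
        ((hcon N₁).1 ((leftParallel F H).trans' hML hL₁))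
    have heq : N₁ = N₂ := rightParallel_unique h4
      ((rightParallel F H).trans' ((rightParallel F H).symm' hr) hL₂) hy
      ⟨1, h1, mul_one y⟩ ⟨1, h1, one_mul y⟩
    have hmem : y * g ∈ N₂.1 := heq ▸ ⟨g, hgL, rfl⟩
    obtain ⟨g', hg', h⟩ := hmem
    exact ⟨g', hg', h.symm⟩
  have hx0 : x ≠ 0 := by rintro rfl; exact hx (by simp)
  have hx1 : 1 + x ≠ 0 := by
    intro h
    rw [eq_neg_of_add_eq_zero_right h] at hx
    exact hx (by simp)
  obtain ⟨a, ha, hax⟩ := hnorm x hx0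
  obtain ⟨b, hb, hbx⟩ := hnorm (1 + x) hx1
  have hcommL : ∀ z ∈ L.1, z * g = g * z := by
    intro z hz
    rw [hspan] at hz
    obtain ⟨r, s, rfl⟩ := Submodule.mem_span_pair.1 hz
    simp only [mul_add, add_mul, mul_smul_comm, smul_mul_assoc, one_mul, mul_one]
  have hkey : g - b = (b - a) * x := by
    rw [add_mul, one_mul, hax, mul_add, mul_one] at hbx
    rw [sub_mul, sub_eq_sub_iff_add_eq_add, hbx, add_comm]
  by_cases hab : b - a = 0
  · rw [hab, zero_mul, sub_eq_zero] at hkey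
    rw [sub_eq_zero, ← hkey] at hab
    rw [← hab] at hax
    exact hx hax
  · -- Here `x = (b - a)⁻¹ (g - b)` with both factors commuting with `g`.
    apply hx
    apply mul_left_cancel₀ hab
    rw [← mul_assoc, ← mul_assoc, ← hkey, hcommL _ (sub_mem hgL hb),
      hcommL _ (sub_mem hb ha), mul_assoc, hkey]

theorem nonempty_algEquiv_of_linked [IsCentral F H] (h4 : Module.finrank F H = 4)
    (hlink : ∀ M N, ∃ P, leftParallel F H M P ∧ rightParallel F H P N) (K L : Subalgebra F H)
    (hK : IsMaximalSubfield F H K) (hL : IsMaximalSubfield F H L) : Nonempty (K ≃ₐ[F] L) := by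
  have : FiniteDimensional F H := Module.finite_of_finrank_pos (by omega)
  have hrank : ∀ S, IsMaximalSubfield F H S →
      Module.finrank F (Subalgebra.toSubmodule S) = 2 := by
    intro S hS
    obtain ⟨g, hg, rfl⟩ := (isMaximalSubfield_iff h4).1 hS
    rw [toSubmodule_adjoin_singleton h4 hg, finrank_span_one_of_notMem_bot hg]
  obtain ⟨P, ⟨c, hc, hcP⟩, d, hd, hdP⟩ :=
    hlink ⟨Subalgebra.toSubmodule K, hrank K hK⟩ ⟨Subalgebra.toSubmodule L, hrank L hL⟩
  rw [← hcP] at hdP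
  replace hdP : ((Subalgebra.toSubmodule K).map (LinearMap.mulLeft F c)).map
      (LinearMap.mulRight F d) = Subalgebra.toSubmodule L := hdP
  have hmem : ∀ z ∈ K, c * z * d ∈ L := by
    intro z hz
    rw [← Subalgebra.mem_toSubmodule, ← hdP]
    exact ⟨c * z, ⟨z, hz, rfl⟩, rfl⟩
  obtain ⟨_, ⟨k, hk, rfl⟩, hkd⟩ : (1 : H) ∈ ((Subalgebra.toSubmodule K).map
      (LinearMap.mulLeft F c)).map (LinearMap.mulRight F d) := by
    rw [hdP]; exact L.one_mem
  have hkd : c * k * d = 1 := hkd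
  -- As `c k d = 1`, conjugation by `c` is `z ↦ c (z k) d`, which maps `K` to `L`.
  let e : H ≃ₐ[F] H := MulSemiringAction.toAlgEquiv F H (ConjAct.toConjAct (Units.mk0 c hc))
  have he : ∀ z, e z = c * z * c⁻¹ := fun z => rfl
  have hle : K.map (e : H →ₐ[F] H) ≤ L := by
    rintro _ ⟨z, hz, rfl⟩
    have hinv : c⁻¹ = k * d := by
      rw [inv_eq_iff_eq_inv, eq_comm, inv_eq_of_mul_eq_one_left]
      rwa [← mul_assoc]
    have := hmem (z * k) (K.mul_mem hz hk)
    change e z ∈ L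
    rw [he, hinv]
    simpa only [mul_assoc] using this
  have heq : K.map (e : H →ₐ[F] H) = L := by
    apply Subalgebra.eq_of_le_of_finrank_eq hle
    rw [← (e.subalgebraMap K).toLinearEquiv.finrank_eq]
    exact (hrank K hK).trans (hrank L hL).symm
  exact ⟨(e.subalgebraMap K).trans (Subalgebra.equivOfEq _ _ heq)⟩

/-- Over a Pythagorean field, a nonzero pure ordinary quaternion can be scaled to have square
`-1`. -/
theorem ProjLine.exists_eq_span_one_of_ordinary (hF : IsPythagoreanField F)
    (hH : IsOrdinaryQuaternionSkewField F H) {L : ProjLine F H} (h1 : (1 : H) ∈ L.1) :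
    ∃ u : H, u * u = -1 ∧ L.1 = Submodule.span F {1, u} := by
  obtain ⟨e⟩ := hH
  obtain ⟨g₀, hg₀L, hg₀⟩ := L.exists_mem_notMem_bot
  let g := g₀ - algebraMap F H (e g₀).re
  have hgL : g ∈ L.1 := by
    refine sub_mem hg₀L ?_
    rw [Algebra.algebraMap_eq_smul_one]
    exact L.1.smul_mem _ h1
  have hg : g ∉ (⊥ : Subalgebra F H) := by
    intro h
    have := add_mem h (algebraMap_mem (⊥ : Subalgebra F H) (e g₀).re)
    rw [sub_add_cancel] at this
    exact hg₀ this
  obtain ⟨r, hr⟩ := hF (e g₀).imI (e g₀).imJ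
  obtain ⟨s, hs⟩ := hF r (e g₀).imK
  have hgg : g * g = (-(s * s)) • (1 : H) := by
    obtain ⟨w, hw⟩ : ∃ w, w = -(s * s) := ⟨_, rfl⟩
    apply e.injective
    rw [← hw, ← Algebra.algebraMap_eq_smul_one, map_mul, map_sub, AlgEquiv.commutes,
      AlgEquiv.commutes]
    ext
    · simp
      linear_combination -hr - hs - hw
    all_goals
      simp
      ring
  have hs0 : s ≠ 0 := by
    rintro rfl
    rw [mul_zero, neg_zero, zero_smul, mul_self_eq_zero] at hgg
    exact hg (hgg ▸ zero_mem _)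
  refine ⟨s⁻¹ • g, ?_, L.eq_span_one h1 (L.1.smul_mem _ hgL)
    fun h => hg (mem_bot_of_smul_mem_bot (inv_ne_zero hs0) h)⟩
  rw [smul_mul_smul_comm, hgg, smul_smul, ← neg_one_smul F (1 : H)]
  congr 1
  field_simp

/-- Two square roots `u`, `v` of `-1` satisfy `u (u + v) = (u + v) v`, so the subfields they
generate are conjugate, unless `v = -u`, in which case these subfields agree. -/
theorem exists_map_mulLeft_eq_map_mulRight {u v : H} (hu : u * u = -1) (hv : v * v = -1) :
    ∃ c : H, c ≠ 0 ∧ (Submodule.span F {1, u}).map (LinearMap.mulLeft F c) =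
      (Submodule.span F {1, v}).map (LinearMap.mulRight F c) := by
  by_cases huv : v + u = 0
  · refine ⟨1, one_ne_zero, ?_⟩
    rw [LinearMap.mulLeft_one, LinearMap.mulRight_one, Submodule.map_id, Submodule.map_id,
      eq_neg_of_add_eq_zero_left huv]
    apply le_antisymm <;> rw [Submodule.span_le]
    · rintro x (rfl | rfl)
      · exact Submodule.subset_span (by simp)
      · rw [← neg_neg x]
        exact neg_mem (Submodule.subset_span (by simp))
    · rintro x (rfl | rfl)
      · exact Submodule.subset_span (by simp)
      · exact neg_mem (Submodule.subset_span (by simp))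
  · refine ⟨v + u, huv, ?_⟩
    rw [Submodule.map_span, Submodule.map_span, Set.image_pair, Set.image_pair]
    simp only [LinearMap.mulLeft_apply, LinearMap.mulRight_apply, one_mul, mul_one, add_mul,
      mul_add, hu, hv]
    rw [add_comm (v * u)]

theorem linked_of_ordinary (hF : IsPythagoreanField F)
    (hH : IsOrdinaryQuaternionSkewField F H) (M N : ProjLine F H) :
    ∃ P, leftParallel F H M P ∧ rightParallel F H P N := by
  obtain ⟨M', hM, hM1⟩ := exists_leftParallel_one_mem M
  obtain ⟨N', hN, hN1⟩ := exists_rightParallel_one_mem N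
  obtain ⟨u, hu, hMu⟩ := M'.exists_eq_span_one_of_ordinary hF hH hM1
  obtain ⟨v, hv, hNv⟩ := N'.exists_eq_span_one_of_ordinary hF hH hN1
  obtain ⟨c, hc, h⟩ := exists_map_mulLeft_eq_map_mulRight (F := F) hu hv
  rw [← hMu, ← hNv] at h
  let P : ProjLine F H := ⟨_, (finrank_map_mulLeft hc M'.1).trans M'.2⟩
  have hP : rightParallel F H N' P := ⟨c, hc, h.symm⟩
  exact ⟨P, (leftParallel F H).trans' hM ⟨c, hc, rfl⟩, (rightParallel F H).symm'
    ((rightParallel F H).trans' hN hP)⟩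

end Conjugacy

theorem theorem4p9 (F H : Type*) [Field F] [DivisionRing H] [Algebra F H]
    [Algebra.IsCentral F H] (h4 : Module.finrank F H = 4) :
    List.TFAE [
      (IsFormallyRealField F ∧ IsPythagoreanField F) ∧ IsOrdinaryQuaternionSkewField F H,
      ∀ K L : Subalgebra F H, IsMaximalSubfield F H K → IsMaximalSubfield F H L →
        Nonempty (K ≃ₐ[F] L),
      {s : Setoid (ProjLine F H) | (cliffordDoubleSpace F H h4).IsCliffordLike s} =
        {(cliffordDoubleSpace F H h4).left, (cliffordDoubleSpace F H h4).right}] := by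
  have hiff := (cliffordDoubleSpace F H h4).setOf_isCliffordLike_eq_iff
    leftParallel_rightParallel_comm (exists_not_leftParallel_iff_rightParallel h4)
  tfae_have 1 → 3 := fun h => hiff.2 (linked_of_ordinary h.1.2 h.2)
  tfae_have 3 → 2 := fun h => nonempty_algEquiv_of_linked h4 (hiff.1 h)
  tfae_have 2 → 1 := quaternion_of_isomorphic h4
  tfae_finish
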